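/- **Setting.** Let $p\ge 1$, $f(x)=\sum_{i=1}^p f_i(x_i)$, $\mathcal X=\prod_{i=1}^p X_i$, $A=[A_1,\dots,A_p]\in\mathbb R^{m\times n}$, $b\in\mathbb R^m$, where $x_i\in\mathbb R^{n_i}$, each $f_i:\mathbb R^{n_i}\to\mathbb R\cup\{+\infty\}$ is proper, closed and convex and each $X_i\subseteq\mathbb R^{n_i}$ is nonempty, closed and convex. Consider $$f^\star=\min\{f(x): Ax=b,\ x\in\mathcal X\},\qquad g(y)=\inf_{x\in\mathcal X}\{f(x)+y^T(Ax-b)\}\quad(y\in\mathbb R^m).$$ Assume that the minimum is attained and that either (i) $\mathcal X$ is a polytope and $Ax=b$ for some $x\in\mathcal X\cap\mathrm{relint}(\mathrm{dom} f)$, or (ii) $Ax=b$ for some $x\in\mathrm{relint}(\mathcal X\cap\mathrm{dom} f)$. (If $f$ is finite on $\mathbb R^n$, this says that $\mathcal X$ is a polytope or Slater's condition $\{Ax=b\}\cap\mathrm{relint}(\mathcal X)\ne\emptyset$ holds.) Let $\mathcal Y^\star$ be the set of maximizers of $g$ and $D_{\mathcal Y^\star}=\min\{\|y\|_2:y\in\mathcal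 Y^\star\}$. **Bregman distance.** Let $x^c\in\mathcal X$ and $\sigma>0$, let $S=\mathrm{diag}(S_1,\dots,S_p)$ be a block diagonal matrix with $S_p=\mathbb I$, and let $d(Sx,Sz)=\sum_{i=1}^p d_i(S_ix_i,S_iz_i)$, where $d_i(u,v)=h_i(u)-h_i(v)-\nabla h_i(v)^T(u-v)$ is the Bregman distance of a nonnegative function $h_i$ that is differentiable at the points of $S_iX_i$ and $\sigma$-strongly convex on $S_iX_i$. Let $D_{\mathcal X}^S=\sup_{x,z\in\mathcal X}d(Sx,Sz)$, assumed finite, and let $\bar L^g>0$ be a constant with $\|A(x-z)\|_2^2\le\sigma\bar L^g\|S(x-z)\|_2^2$ for all $x,z\in\mathcal X$ (for instance $\bar L^g=\sigma^{-1}\|A\|_2^2$ if $S=\mathbb I$ and $A\neq0$). For $\gamma>0$ let $x^\star_\gamma(y)$ denote a minimizer of $f(x)+y^T(Ax-b)+\gamma d(Sx,Sx^c)$ over $x\in\mathcal X$. **Last block.** Assume that $f_p$ is finite and differentiable on $\mathbb R^{n_p}$ with Lipschitz continuous gradient, that $\lambda_{\min}(A_p^TA_p)>0$, and that $h_p$ is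 differentiable on $\mathbb R^{n_p}$ with $1$-Lipschitz gradient. **Scheme (1P2D).** For $k\ge0$ let $\tau_k=\frac1{k+2}$, $\gamma_0=\beta_0=\sqrt{\bar L^g}$, $\gamma_{k+1}=\bigl(1-\frac{\tau_k}{1+\tau_k}\bigr)\gamma_k$ and $\beta_{k+1}=(1-\tau_k)\beta_k$. Let $$\hat y^k=(1-\tau_k)\bar y^k+\tau_k\beta_k^{-1}(A\bar x^k-b),\qquad \bar x^{k+1}=(1-\tau_k)\bar x^k+\tau_k x^\star_{\gamma_{k+1}}(\hat y^k),$$ $$\bar y^{k+1}=\hat y^k+\frac{\gamma_{k+1}}{\bar L^g}\bigl(Ax^\star_{\gamma_{k+1}}(\hat y^k)-b\bigr),$$ with the same minimizer $x^\star_{\gamma_{k+1}}(\hat y^k)$ in both formulas. The starting point is $\bar x^0=x^\star_{\gamma_0}(0)$, $\bar y^0=\beta_0^{-1}(A\bar x^0-b)$ or, if $\sigma=1$, alternatively $\bar y^0=\beta_0^{-1}(Ax^c-b)$ and $\bar x^0\in\arg\min_{x\in\mathcal X}\{f(x)+(\bar y^0)^TA(x-x^c)+\frac{\bar L^g}{2\beta_0}\|S(x-x^c)\|_2^2\}$.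 Assume that the constraint on the last block is not active in the subproblems solved: for every $k\ge0$ the minimum over $u\in\mathbb R^{n_p}$ of $f_p(u)+(\hat y^k)^TA_pu+\gamma_{k+1}d_p(u,x_p^c)$ is attained at a point of $X_p$. **Claim.** The set $\mathcal Y^\star$ is nonempty and $D_{\mathcal Y^\star}$ is attained. For every $k\ge0$ we have $\bar x^k\in\mathcal X$, $f(\bar x^k)<+\infty$ and $$\|A\bar x^k-b\|_2\le\frac{2\sqrt{2\bar L^g}\,\bigl(D_{\mathcal Y^\star}+\sqrt{D_{\mathcal X}^S}\bigr)}{k+1},\qquad -D_{\mathcal Y^\star}\|A\bar x^k-b\|_2\le f(\bar x^k)-f^\star\le\frac{2\sqrt{2\bar L^g}}{k+1}\,D_{\mathcal X}^S .$$ In particular no horizon has to be fixed in advance. -/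

import Mathlib

open scoped RealInnerProductSpace

noncomputable section

namespace SepConvex

/-- `ℝᵈ` with the Euclidean norm. -/
abbrev Vec (d : ℕ) : Type := EuclideanSpace ℝ (Fin d)

/-- A point of `ℝⁿ = ℝ^{n_1} × ⋯ × ℝ^{n_p}`, where `p = r + 1`, given by its blocks. -/
abbrev Blocks {r : ℕ} (n : Fin (r + 1) → ℕ) : Type := ∀ i, Vec (n i)

/-- The data of the separable problem `min { ∑ f_i(x_i) : ∑ A_i x_i = b, x_i ∈ X_i }` with
`p = r + 1` blocks. A function `f_i` with values in `ℝ ∪ {+∞}` is given by its domain `dom i`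
and by its (real) values `f i` there; the values of `f i` outside `dom i` are never used. -/
structure Problem (m r : ℕ) (n : Fin (r + 1) → ℕ) where
  f : ∀ i, Vec (n i) → ℝ
  dom : ∀ i, Set (Vec (n i))
  X : ∀ i, Set (Vec (n i))
  A : ∀ i, Matrix (Fin m) (Fin (n i)) ℝ
  b : Vec m

/-- A function with values in `ℝ ∪ {+∞}`, given by its domain `D` and its values `φ` on `D`, is
proper, closed and convex: `D` is nonempty, `φ` is convex on the convex set `D`, and the
epigraph is closed. -/
def IsProperClosedConvex {d : ℕ} (D : Set (Vec d)) (φ : Vec d → ℝ) : Prop :=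
  D.Nonempty ∧ ConvexOn ℝ D φ ∧ IsClosed {z : Vec d × ℝ | z.1 ∈ D ∧ φ z.1 ≤ z.2}

/-- The matrix `M` acting on column vectors. -/
def app {k d : ℕ} (M : Matrix (Fin k) (Fin d) ℝ) (u : Vec d) : Vec k :=
  Matrix.toEuclideanLin M u

namespace Problem

variable {m r : ℕ} {n : Fin (r + 1) → ℕ} (P : Problem m r n)

/-- The objective `f(x) = ∑ f_i(x_i)`. -/
def obj (x : Blocks n) : ℝ := ∑ i, P.f i (x i)

/-- The domain of `f`. -/
def domain : Set (Blocks n) := {x | ∀ i, x i ∈ P.dom i}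

/-- The set `𝒳 = ∏ X_i`. -/
def constraint : Set (Blocks n) := {x | ∀ i, x i ∈ P.X i}

/-- The residual `A x - b`. -/
def res (x : Blocks n) : Vec m := (∑ i, app (P.A i) (x i)) - P.b

/-- The points of `𝒳` with `A x = b` and `f(x) < +∞`. -/
def feasible : Set (Blocks n) := {x | x ∈ P.constraint ∩ P.domain ∧ P.res x = 0}

/-- The problem has an optimal solution. -/
def HasSolution : Prop := ∃ x ∈ P.feasible, IsMinOn P.obj P.feasible x

/-- The optimal value `f⋆`. -/
def optValue : ℝ := sInf (P.obj '' P.feasible)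

/-- The dual function `g(y) = inf { f(x) + yᵀ(A x - b) : x ∈ 𝒳 }`, with values in `[-∞, +∞]`. -/
def dualFun (y : Vec m) : EReal :=
  ⨅ x ∈ P.constraint ∩ P.domain, ((P.obj x + ⟪y, P.res x⟫ : ℝ) : EReal)

/-- The set `𝒴⋆` of the maximizers of the dual function. -/
def dualSolutions : Set (Vec m) := {y | ∀ z, P.dualFun z ≤ P.dualFun y}

/-- `D_{𝒴⋆}`, the norm of a minimum norm dual solution. -/
def dualRadius : ℝ := sInf ((fun y => ‖y‖) '' P.dualSolutions)

/-- The standing assumption: each `f_i` is proper, closed and convex, each `X_i` is nonempty,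
closed and convex, there is an optimal solution, and either `𝒳` is a polytope, or `A x = b` holds
at some point of the relative interior of `𝒳`. The domain of `f` is taken into account in both
cases; where `f` is finite on all of `ℝⁿ`, the two cases are exactly those just named. -/
def Standing : Prop :=
  (∀ i, IsProperClosedConvex (P.dom i) (P.f i)) ∧
  (∀ i, (P.X i).Nonempty ∧ IsClosed (P.X i) ∧ Convex ℝ (P.X i)) ∧
  P.HasSolution ∧
  (((∃ s : Set (Blocks n), s.Finite ∧ P.constraint = convexHull ℝ s) ∧
      ∃ x ∈ P.constraint, x ∈ intrinsicInterior ℝ P.domain ∧ P.res x = 0) ∨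
    ∃ x ∈ intrinsicInterior ℝ (P.constraint ∩ P.domain), P.res x = 0)

end Problem

/-- `φ` is differentiable on `ℝᵈ` and `∇φ` is Lipschitz continuous with constant `L`. -/
def IsLipschitzGradient {d : ℕ} (L : NNReal) (φ : Vec d → ℝ) : Prop :=
  Differentiable ℝ φ ∧ LipschitzWith L (gradient φ)

/-- The Bregman distance `h(u) - h(v) - ∇h(v)ᵀ(u - v)`. -/
def bregman {d : ℕ} (h : Vec d → ℝ) (u v : Vec d) : ℝ :=
  h u - h v - ⟪gradient h v, u - v⟫

/-- `h` is a smooth prox-function of `K` with strong convexity parameter `σ` (its continuity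
follows from its differentiability). -/
def IsProxFunction {d : ℕ} (h : Vec d → ℝ) (K : Set (Vec d)) (σ : ℝ) : Prop :=
  (∀ u ∈ K, 0 ≤ h u) ∧ StrongConvexOn K σ h ∧ ∀ u ∈ K, DifferentiableAt ℝ h u

/-- The data of a separable Bregman distance: for each of the first `r = p - 1` blocks a matrix
`S_i` and a prox-function, for the last block a prox-function only (its matrix is the identity),
and the prox-center `x^c`. -/
structure Smoother {r : ℕ} (n : Fin (r + 1) → ℕ) where
  q : Fin r → ℕ
  S : ∀ i : Fin r, Matrix (Fin (q i)) (Fin (n i.castSucc)) ℝ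
  h : ∀ i : Fin r, Vec (q i) → ℝ
  hLast : Vec (n (Fin.last r)) → ℝ
  center : Blocks n

namespace Smoother

variable {m r : ℕ} {n : Fin (r + 1) → ℕ} (B : Smoother n)

/-- The Bregman distance `d(S x, S z) = ∑ d_i(S_i x_i, S_i z_i)`, where `S_p` is the identity. -/
def dist (x z : Blocks n) : ℝ :=
  (∑ i : Fin r, bregman (B.h i) (app (B.S i) (x i.castSucc)) (app (B.S i) (z i.castSucc))) +
    bregman B.hLast (x (Fin.last r)) (z (Fin.last r))

/-- The square `‖S x‖²` of the Euclidean norm of `S x`. -/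
def normSqS (x : Blocks n) : ℝ :=
  (∑ i : Fin r, ‖app (B.S i) (x i.castSucc)‖ ^ 2) + ‖x (Fin.last r)‖ ^ 2

/-- The values `d(S x, S z)` for `x` and `z` in `𝒳`. -/
def proxValues (P : Problem m r n) : Set ℝ :=
  {t | ∃ x ∈ P.constraint, ∃ z ∈ P.constraint, t = B.dist x z}

/-- The projected prox-diameter `D_𝒳^S`. -/
def proxDiameter (P : Problem m r n) : ℝ := sSup (B.proxValues P)

/-- The center lies in `𝒳`, and the functions that define the Bregman distance are smooth
`σ`-strongly convex prox-functions of the sets `S_i X_i`. -/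
def IsSmoother (P : Problem m r n) (σ : ℝ) : Prop :=
  B.center ∈ P.constraint ∧
  (∀ i : Fin r, IsProxFunction (B.h i) (app (B.S i) '' P.X i.castSucc) σ) ∧
  IsProxFunction B.hLast (P.X (Fin.last r)) σ

/-- `L` is an admissible constant `L̄ᵍ`: `‖A(x - z)‖² ≤ σ L ‖S(x - z)‖²` for `x, z ∈ 𝒳`. For
`S = I` and `A ≠ 0` this holds with `L = σ⁻¹‖A‖²`. -/
def IsSmoothingConstant (P : Problem m r n) (σ L : ℝ) : Prop :=
  0 < L ∧ ∀ x ∈ P.constraint, ∀ z ∈ P.constraint,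
    ‖P.res x - P.res z‖ ^ 2 ≤ σ * L * B.normSqS (x - z)

/-- `x` is a point `x⋆_γ(y)`: a minimizer of `f(x) + yᵀ(A x - b) + γ d(S x, S x^c)` over `𝒳`. -/
def IsSmoothedMin (P : Problem m r n) (γ : ℝ) (y : Vec m) (x : Blocks n) : Prop :=
  x ∈ P.constraint ∩ P.domain ∧
  IsMinOn (fun z => P.obj z + ⟪y, P.res z⟫ + γ * B.dist z B.center)
    (P.constraint ∩ P.domain) x

/-- `x` is a value of the proximal step at `(x^c, y)` with parameter `β`: a minimizer of
`f(x) + yᵀA(x - x^c) + (L/(2β)) ‖S(x - x^c)‖²` over `𝒳`. -/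
def IsProxStep (P : Problem m r n) (L β : ℝ) (y : Vec m) (x : Blocks n) : Prop :=
  x ∈ P.constraint ∩ P.domain ∧
  IsMinOn (fun z => P.obj z + ⟪y, P.res z - P.res B.center⟫ +
      L / (2 * β) * B.normSqS (z - B.center))
    (P.constraint ∩ P.domain) x

/-- The constraint `x_p ∈ X_p` on the last block is not active in the subproblem with parameters
`γ` and `y`: the minimum of `f_p(u) + yᵀA_p u + γ d_p(u, x_p^c)` over the whole space is attained
in `X_p`. -/
def LastInactive (P : Problem m r n) (γ : ℝ) (y : Vec m) : Prop :=
  ∃ u ∈ P.X (Fin.last r),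
    IsMinOn (fun v => P.f (Fin.last r) v + ⟪y, app (P.A (Fin.last r)) v⟫ +
      γ * bregman B.hLast v (B.center (Fin.last r))) Set.univ u

end Smoother

/-- The step size `τ_k = 1/(k+2)`. -/
def tau (k : ℕ) : ℝ := 1 / ((k : ℝ) + 2)

/-- `γ_0 = √L` and `γ_{k+1} = (1 - τ_k/(1 + τ_k)) γ_k`. -/
def gam (L : ℝ) : ℕ → ℝ
  | 0 => √L
  | k + 1 => (1 - tau k / (1 + tau k)) * gam L k

/-- `β_0 = √L` and `β_{k+1} = (1 - τ_k) β_k`. -/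
def bet (L : ℝ) : ℕ → ℝ
  | 0 => √L
  | k + 1 => (1 - tau k) * bet L k

namespace Smoother

variable {m r : ℕ} {n : Fin (r + 1) → ℕ} (B : Smoother n)

/-- The point `ŷᵏ = (1 - τ_k) yᵏ + τ_k β_k⁻¹ (A xᵏ - b)`. -/
def yHat (P : Problem m r n) (L : ℝ) (x : ℕ → Blocks n) (y : ℕ → Vec m) (k : ℕ) : Vec m :=
  (1 - tau k) • y k + tau k • ((bet L k)⁻¹ • P.res (x k))

/-- The starting point: either `x⁰ = x⋆_{γ_0}(0)` and `y⁰ = β_0⁻¹(A x⁰ - b)`, or, for a Bregman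
distance with `σ = 1`, `y⁰ = β_0⁻¹(A x^c - b)` and `x⁰` is the proximal step at `(x^c, y⁰)`. -/
def IsStart (P : Problem m r n) (σ L : ℝ) (x₀ : Blocks n) (y₀ : Vec m) : Prop :=
  (B.IsSmoothedMin P (gam L 0) 0 x₀ ∧ y₀ = (bet L 0)⁻¹ • P.res x₀) ∨
  (σ = 1 ∧ y₀ = (bet L 0)⁻¹ • P.res B.center ∧ B.IsProxStep P L (bet L 0) y₀ x₀)

/-- The sequences `x`, `y` are generated by the scheme with one primal and two dual steps. -/
def IsGenerated (P : Problem m r n) (σ L : ℝ) (x : ℕ → Blocks n) (y : ℕ → Vec m) : Prop :=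
  B.IsStart P σ L (x 0) (y 0) ∧
  ∀ k, ∃ xs, B.IsSmoothedMin P (gam L (k + 1)) (yHat P L x y k) xs ∧
    x (k + 1) = (1 - tau k) • x k + tau k • xs ∧
    y (k + 1) = yHat P L x y k + (gam L (k + 1) / L) • P.res xs

end Smoother

end SepConvex

end

/-!
A Hoffman-type error bound for `A x = b`, combined with the convexity of `f`, shows that
`f + K ‖A x - b‖` is an exact penalty function for some finite `K`. By the minimax theorem one `y`
then satisfies `f⋆ ≤ f(x) + yᵀ(A x - b)` on all of `𝒳`; these multipliers are exactly the dual
solutions.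

The scheme maintains Nesterov's excessive gap condition
`f(xᵏ) + ‖A xᵏ - b‖² / (2β_k) ≤ inf_𝒳 (f + (yᵏ)ᵀ(A · - b) + γ_k d(S ·, S x^c))`. By the strong
convexity of the Bregman distance, `d(S ·, S x^c) - ‖A · - b‖² / (2 L̄ᵍ)` is convex; this gives the
smoothed dual function a quadratic lower model, and the condition survives a step as soon as
`L̄ᵍ τ_k² ≤ β_{k+1} γ_{k+1}`. Evaluating the right-hand side at an optimal solution bounds the
objective, and comparing with a dual solution of least norm turns this into a quadratic inequality
for `‖A xᵏ - b‖`.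
-/

namespace SepConvex

section Polytope

/-- The minimum ratio test of the simplex method, over the indices `q` with `0 < c q`. -/
lemma exists_max_mul_weights_le {ι : Type*} {s : Finset ι} {a c : ι → ℝ}
    (ha : ∀ q ∈ s, 0 ≤ a q) (hc : ∀ q ∈ s, 0 ≤ c q) (hpos : ∃ q ∈ s, 0 < c q) :
    ∃ p ∈ s, ∃ t : ℝ, 0 ≤ t ∧ t * c p = a p ∧ ∀ q ∈ s, t * c q ≤ a q := by
  classical
  have hne : (s.filter fun q => 0 < c q).Nonempty := by
    obtain ⟨q, hq, hcq⟩ := hpos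
    exact ⟨q, Finset.mem_filter.2 ⟨hq, hcq⟩⟩
  obtain ⟨p, hp, hmin⟩ := Finset.exists_min_image _ (fun q => a q / c q) hne
  obtain ⟨hps, hcp⟩ := Finset.mem_filter.1 hp
  refine ⟨p, hps, a p / c p, div_nonneg (ha p hps) hcp.le, div_mul_cancel₀ _ hcp.ne',
    fun q hq => ?_⟩
  rcases (hc q hq).eq_or_lt with h0 | h0
  · rw [← h0, mul_zero]
    exact ha q hq
  · exact (le_div_iff₀ h0).1 (hmin q (Finset.mem_filter.2 ⟨hq, h0⟩))

variable {E : Type*} [AddCommGroup E] [Module ℝ E]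

lemma exists_mem_segment_convexHull_erase [DecidableEq E] {s : Finset E} {x z : E}
    (hx : x ∈ convexHull ℝ (s : Set E)) (hz : z ∈ convexHull ℝ (s : Set E)) (hxz : x ≠ z) :
    ∃ p ∈ s, ∃ v ∈ convexHull ℝ (s.erase p : Set E), ∃ t : ℝ, 0 ≤ t ∧ t < 1 ∧
      x = t • z + (1 - t) • v := by
  obtain ⟨a, ha, ha1, rfl⟩ := Finset.mem_convexHull'.1 hx
  obtain ⟨c, hc, hc1, rfl⟩ := Finset.mem_convexHull'.1 hz
  have hpos : ∃ q ∈ s, 0 < c q := Finset.exists_lt_of_sum_lt (f := fun _ => 0) (by simp [hc1])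
  obtain ⟨p, hp, t, ht0, hpt, hle⟩ := exists_max_mul_weights_le ha hc hpos
  have ht1 : t ≤ 1 := by
    simpa only [← Finset.mul_sum, hc1, ha1, mul_one] using Finset.sum_le_sum hle
  have htne : t ≠ 1 := by
    rintro rfl
    simp only [one_mul] at hle
    have heq := (Finset.sum_eq_sum_iff_of_le hle).1 (hc1.trans ha1.symm)
    exact hxz (Finset.sum_congr rfl fun q hq => by rw [heq q hq])
  have ht : 0 < 1 - t := sub_pos.2 (lt_of_le_of_ne ht1 htne)
  have hp0 : (1 - t)⁻¹ * (a p - t * c p) = 0 := by rw [hpt, sub_self, mul_zero]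
  refine ⟨p, hp, ∑ q ∈ s.erase p, ((1 - t)⁻¹ * (a q - t * c q)) • q,
    Finset.mem_convexHull'.2 ⟨_, fun q hq => ?_, ?_, rfl⟩, t, ht0, sub_pos.1 ht, ?_⟩
  · exact mul_nonneg (inv_nonneg.2 ht.le) (sub_nonneg.2 (hle q (Finset.mem_of_mem_erase hq)))
  · rw [Finset.sum_erase (f := fun q => (1 - t)⁻¹ * (a q - t * c q)) _ hp0, ← Finset.mul_sum,
      Finset.sum_sub_distrib, ← Finset.mul_sum, ha1, hc1, mul_one, inv_mul_cancel₀ ht.ne']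
  · rw [Finset.sum_erase _ (by rw [hp0, zero_smul]), Finset.smul_sum, Finset.smul_sum,
      ← Finset.sum_add_distrib]
    refine Finset.sum_congr rfl fun q _ => ?_
    rw [smul_smul, smul_smul, mul_inv_cancel_left₀ ht.ne', ← add_smul, add_sub_cancel]

end Polytope

section AffineMap

variable {E : Type*} [AddCommGroup E] [Module ℝ E]

lemma mem_affineSubspace_of_smul_add_smul_mem {M : AffineSubspace ℝ E} {z v : E} {t : ℝ}
    (ht : t ≠ 1) (hz : z ∈ M) (h : t • z + (1 - t) • v ∈ M) : v ∈ M := by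
  have ht' : 1 - t ≠ 0 := sub_ne_zero.2 ht.symm
  have hv : AffineMap.lineMap z (t • z + (1 - t) • v) (1 - t)⁻¹ = v := by
    have hsub : t • z + (1 - t) • v - z = (1 - t) • (v - z) := by module
    rw [AffineMap.lineMap_apply_module', hsub, inv_smul_smul₀ ht', sub_add_cancel]
  exact hv ▸ AffineMap.lineMap_mem _ hz h

end AffineMap

section ErrorBound

variable {E W : Type*} [NormedAddCommGroup E] [NormedAddCommGroup W]

/-- A global linear error bound in the sense of Hoffman: each point `x` of `K` has a zero of `T`
in `K` within a constant multiple of `‖T x‖`. -/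
def HasErrorBound (K : Set E) (T : E → W) : Prop :=
  ∃ H : ℝ, 0 ≤ H ∧ ∀ x ∈ K, ∃ z ∈ K, T z = 0 ∧ ‖x - z‖ ≤ H * ‖T x‖

lemma exists_norm_sub_le_mul_norm_of_ne_zero {K : Set E} (hK : IsCompact K) {T : E → W}
    (hT : ContinuousOn T K) (hT0 : ∀ x ∈ K, T x ≠ 0) (z : E) :
    ∃ H : ℝ, 0 ≤ H ∧ ∀ x ∈ K, ‖x - z‖ ≤ H * ‖T x‖ := by
  have hcont : ContinuousOn (fun x => ‖x - z‖ / ‖T x‖) K :=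
    (by fun_prop : ContinuousOn (fun x => ‖x - z‖) K).div hT.norm
      fun x hx => norm_ne_zero_iff.2 (hT0 x hx)
  obtain ⟨H, hH⟩ := hK.bddAbove_image hcont
  refine ⟨max H 0, le_max_right _ _, fun x hx => ?_⟩
  rw [← div_le_iff₀ (norm_pos_iff.2 (hT0 x hx))]
  exact (hH (Set.mem_image_of_mem _ hx)).trans (le_max_left _ _)

variable [NormedSpace ℝ E] [NormedSpace ℝ W] [FiniteDimensional ℝ E]

/-- On the facets without a zero of `T` the point `z₀` serves as the nearby zero. -/
lemma exists_errorBound_face {K F : Set E} (hF : IsCompact F) (hFK : F ⊆ K) (T : E →ᵃ[ℝ] W)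
    {z₀ : E} (hz₀ : z₀ ∈ K) (hTz₀ : T z₀ = 0)
    (h : ∀ z ∈ F, T z = 0 → HasErrorBound F T) :
    ∃ H : ℝ, 0 ≤ H ∧ ∀ v ∈ F, ∃ z ∈ K, T z = 0 ∧ ‖v - z‖ ≤ H * ‖T v‖ := by
  by_cases hz : ∃ z ∈ F, T z = 0
  · obtain ⟨z, hz, hTz⟩ := hz
    obtain ⟨H, hH, hbound⟩ := h z hz hTz
    refine ⟨H, hH, fun v hv => ?_⟩
    obtain ⟨w, hw, hTw⟩ := hbound v hv
    exact ⟨w, hFK hw, hTw⟩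
  · push Not at hz
    obtain ⟨H, hH, hbound⟩ := exists_norm_sub_le_mul_norm_of_ne_zero hF
      T.continuous_of_finiteDimensional.continuousOn hz z₀
    exact ⟨H, hH, fun v hv => ⟨z₀, hz₀, hTz₀, hbound v hv⟩⟩

/-- Hoffman's bound. A point of the polytope lies on a segment from `z₀` to a point `v` of a facet;
both the distance to the zeros and `T` shrink by the same factor from `v` to that point. -/
theorem hasErrorBound_convexHull_inter (T : E →ᵃ[ℝ] W) (M : AffineSubspace ℝ E) (s : Finset E)
    {z₀ : E} (hz₀ : z₀ ∈ convexHull ℝ (s : Set E) ∩ M) (hTz₀ : T z₀ = 0) :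
    HasErrorBound (convexHull ℝ (s : Set E) ∩ M) T := by
  classical
  induction s using Finset.strongInduction generalizing z₀ with
  | H s ih =>
  have hconv : Convex ℝ (convexHull ℝ (s : Set E) ∩ M) := (convex_convexHull ℝ _).inter M.convex
  have hfacet : ∀ p ∈ s, ∃ H : ℝ, 0 ≤ H ∧ ∀ v ∈ convexHull ℝ (s.erase p : Set E) ∩ M,
      ∃ z ∈ convexHull ℝ (s : Set E) ∩ M, T z = 0 ∧ ‖v - z‖ ≤ H * ‖T v‖ := by
    intro p hp
    refine exists_errorBound_face
      (((s.erase p).finite_toSet.isCompact_convexHull ℝ).inter_right M.closed_of_finiteDimensional)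
      (Set.inter_subset_inter_left _ ?_) T hz₀ hTz₀ fun z hz hTz => ?_
    · exact convexHull_mono (Finset.coe_subset.2 (s.erase_subset p))
    · exact ih _ (Finset.erase_ssubset hp) hz hTz
  choose! H hH0 hH using hfacet
  refine ⟨∑ p ∈ s, H p, Finset.sum_nonneg hH0, fun x ⟨hxs, hxM⟩ => ?_⟩
  rcases eq_or_ne x z₀ with rfl | hne
  · exact ⟨x, ⟨hxs, hxM⟩, hTz₀, by simp [hTz₀]⟩
  obtain ⟨p, hp, v, hv, t, ht0, ht1, rfl⟩ := exists_mem_segment_convexHull_erase hxs hz₀.1 hne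
  have hvM : v ∈ M := mem_affineSubspace_of_smul_add_smul_mem ht1.ne hz₀.2 hxM
  obtain ⟨z, hz, hTz, hle⟩ := hH p hp v ⟨hv, hvM⟩
  refine ⟨t • z₀ + (1 - t) • z, hconv hz₀ hz ht0 (sub_pos.2 ht1).le (by ring), ?_, ?_⟩
  · rw [Convex.combo_affine_apply (f := T) (by ring), hTz₀, hTz, smul_zero, smul_zero, add_zero]
  · rw [add_sub_add_left_eq_sub, ← smul_sub, Convex.combo_affine_apply (f := T) (by ring), hTz₀,
      smul_zero, zero_add, norm_smul, norm_smul, mul_left_comm]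
    gcongr
    exact hle.trans (by gcongr; exact Finset.single_le_sum hH0 hp)

theorem hasErrorBound_affineSubspace (T : E →ᵃ[ℝ] W) (M : AffineSubspace ℝ E) {z₀ : E}
    (hz₀ : z₀ ∈ M) (hTz₀ : T z₀ = 0) : HasErrorBound (M : Set E) T := by
  let l : M.direction →ₗ[ℝ] W := T.linear.comp M.direction.subtype
  have hT : ∀ (x : E) (u : M.direction), T (x - u) = T x - l u := fun x u => by
    have h := T.map_vadd x (-(u : E))
    rw [map_neg, vadd_eq_add, vadd_eq_add, neg_add_eq_sub, neg_add_eq_sub] at h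
    exact h
  obtain ⟨g, hg⟩ := l.rangeRestrict.exists_rightInverse_of_surjective l.range_rangeRestrict
  let G : l.range →L[ℝ] M.direction := LinearMap.toContinuousLinearMap g
  refine ⟨‖G‖, norm_nonneg G, fun x hx => ?_⟩
  let d : M.direction := ⟨x - z₀, AffineSubspace.vsub_mem_direction hx hz₀⟩
  have hld : l d = T x := by
    have h := hT x d
    rw [sub_sub_cancel, hTz₀] at h
    exact (sub_eq_zero.1 h.symm).symm
  let w : M.direction := g (l.rangeRestrict d)
  have hlw : l w = T x :=
    (congrArg Subtype.val (LinearMap.congr_fun hg (l.rangeRestrict d))).trans hld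
  refine ⟨x - w, ?_, by rw [hT, hlw, sub_self], ?_⟩
  · simpa [neg_add_eq_sub] using
      AffineSubspace.vadd_mem_of_mem_direction (M.direction.neg_mem w.2) hx
  · rw [sub_sub_cancel, ← hld]
    exact G.le_opNorm (l.rangeRestrict d)

end ErrorBound

section ExactPenalty

section

variable {E W : Type*} [AddCommGroup E] [Module ℝ E] [AddCommGroup W] [Module ℝ W]

/-- The point `(x + θ p) / (1 + θ) = (z + θ x₀) / (1 + θ)` is feasible. -/
lemma one_add_mul_le_add_mul_of_zeros {Q D : Set E} {φ : E → ℝ} (hφ : ConvexOn ℝ D φ)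
    (hQ : Convex ℝ Q) (T : E →ᵃ[ℝ] W) {v : ℝ} (hv : ∀ x ∈ Q ∩ D, T x = 0 → v ≤ φ x)
    {x z x₀ p : E} (hx : x ∈ D) (hp : p ∈ D) (hz : z ∈ Q) (hTz : T z = 0) (hx₀ : x₀ ∈ Q)
    (hTx₀ : T x₀ = 0) {θ : ℝ} (hθ : 0 < θ) (h : x + θ • p = z + θ • x₀) :
    (1 + θ) * v ≤ φ x + θ * φ p := by
  have ha : 0 ≤ (1 + θ)⁻¹ := by positivity
  have hc : 0 ≤ (1 + θ)⁻¹ * θ := by positivity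
  have hac : (1 + θ)⁻¹ + (1 + θ)⁻¹ * θ = 1 := by field_simp
  have hpt : (1 + θ)⁻¹ • x + ((1 + θ)⁻¹ * θ) • p = (1 + θ)⁻¹ • z + ((1 + θ)⁻¹ * θ) • x₀ := by
    rw [mul_smul, mul_smul, ← smul_add, ← smul_add, h]
  have hfeas : v ≤ φ ((1 + θ)⁻¹ • x + ((1 + θ)⁻¹ * θ) • p) := by
    refine hv _ ⟨?_, hφ.1 hx hp ha hc hac⟩ ?_
    · exact hpt ▸ hQ hz hx₀ ha hc hac
    · rw [hpt, Convex.combo_affine_apply (f := T) hac, hTz, hTx₀, smul_zero, smul_zero, add_zero]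
  calc (1 + θ) * v ≤ (1 + θ) * ((1 + θ)⁻¹ * φ x + (1 + θ)⁻¹ * θ * φ p) := by
        gcongr
        exact hfeas.trans (hφ.2 hx hp ha hc hac)
    _ = φ x + θ * φ p := by field_simp

end

variable {E W : Type*} [NormedAddCommGroup E] [NormedSpace ℝ E] [FiniteDimensional ℝ E]
  [NormedAddCommGroup W] [NormedSpace ℝ W]

lemma exists_forall_le_of_mem_intrinsicInterior {D : Set E} {φ : E → ℝ} {x₀ : E}
    (hφ : ConvexOn ℝ D φ) (hx₀ : x₀ ∈ intrinsicInterior ℝ D) :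
    ∃ δ > 0, ∃ C : ℝ, ∀ p ∈ affineSpan ℝ D, ‖p - x₀‖ < δ → p ∈ D ∧ φ p ≤ C := by
  obtain ⟨y, hy, rfl⟩ := mem_intrinsicInterior.1 hx₀
  have : Nonempty (affineSpan ℝ D) := ⟨y⟩
  let e := AffineIsometryEquiv.vaddConst ℝ y
  let ι := (affineSpan ℝ D).subtype.comp e.toAffineEquiv.toAffineMap
  have hint : e.symm y ∈ interior (ι ⁻¹' D) := by
    have h : ι ⁻¹' D = e.toHomeomorph ⁻¹' ((↑) ⁻¹' D) := rfl
    rw [h, ← e.toHomeomorph.preimage_interior, Set.mem_preimage]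
    simpa using hy
  have hcont : ContinuousAt (φ ∘ ι) (e.symm y) :=
    (hφ.comp_affineMap ι).continuousOn_interior.continuousAt (isOpen_interior.mem_nhds hint)
  have hev : ∀ᶠ w in nhds (e.symm y), ι w ∈ D ∧ φ (ι w) < φ (ι (e.symm y)) + 1 :=
    (Filter.eventually_mem_set.2 (mem_interior_iff_mem_nhds.1 hint)).and
      (hcont.eventually_lt_const (lt_add_one _))
  obtain ⟨δ, hδ, hball⟩ := Metric.eventually_nhds_iff.1 hev
  refine ⟨δ, hδ, φ (ι (e.symm y)) + 1, fun p hp hpδ => ?_⟩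
  have hι : ι (e.symm ⟨p, hp⟩) = p := congrArg Subtype.val (e.apply_symm_apply _)
  have h := @hball (e.symm ⟨p, hp⟩) (by rwa [e.symm.dist_map, Subtype.dist_eq, dist_eq_norm])
  rw [hι] at h
  exact ⟨h.1, h.2.le⟩

theorem exists_exact_penalty_of_hasErrorBound {Q D : Set E} {φ : E → ℝ} (hφ : ConvexOn ℝ D φ)
    (hQ : Convex ℝ Q) (T : E →ᵃ[ℝ] W) (hT : HasErrorBound (Q ∩ affineSpan ℝ D) T) {x₀ : E}
    (hx₀Q : x₀ ∈ Q) (hx₀ : x₀ ∈ intrinsicInterior ℝ D) (hTx₀ : T x₀ = 0) {v : ℝ}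
    (hv : ∀ x ∈ Q ∩ D, T x = 0 → v ≤ φ x) :
    ∃ K : ℝ, 0 ≤ K ∧ ∀ x ∈ Q ∩ D, v ≤ φ x + K * ‖T x‖ := by
  obtain ⟨δ, hδ, C, hC⟩ := exists_forall_le_of_mem_intrinsicInterior hφ hx₀
  obtain ⟨H, hH0, hH⟩ := hT
  have hx₀D : x₀ ∈ D := intrinsicInterior_subset hx₀
  have hvC : v ≤ C := (hv x₀ ⟨hx₀Q, hx₀D⟩ hTx₀).trans
    (hC x₀ (subset_affineSpan ℝ D hx₀D) (by simpa using hδ)).2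
  refine ⟨(H + 1) / δ * (C - v), mul_nonneg (by positivity) (sub_nonneg.2 hvC), ?_⟩
  rintro x ⟨hxQ, hxD⟩
  rcases eq_or_ne (T x) 0 with hTx | hTx
  · simpa [hTx] using hv x ⟨hxQ, hxD⟩ hTx
  obtain ⟨z, ⟨hzQ, hzM⟩, hTz, hxz⟩ := hH x ⟨hxQ, subset_affineSpan ℝ D hxD⟩
  set θ := (H + 1) / δ * ‖T x‖ with hθ
  have hθ0 : 0 < θ := by positivity
  have hpM : θ⁻¹ • (z - x) + x₀ ∈ affineSpan ℝ D := AffineSubspace.smul_vsub_vadd_mem _ _ hzM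
    (subset_affineSpan ℝ D hxD) (subset_affineSpan ℝ D hx₀D)
  have hpδ : ‖θ⁻¹ • (z - x) + x₀ - x₀‖ < δ := by
    rw [add_sub_cancel_right, norm_smul, norm_inv, Real.norm_of_nonneg hθ0.le,
      inv_mul_lt_iff₀ hθ0, norm_sub_rev]
    calc ‖x - z‖ ≤ H * ‖T x‖ := hxz
      _ < (H + 1) * ‖T x‖ := by gcongr; exact lt_add_one H
      _ = θ * δ := by rw [hθ]; field_simp
  obtain ⟨hpD, hpC⟩ := hC _ hpM hpδ
  have hmain := one_add_mul_le_add_mul_of_zeros hφ hQ T hv hxD hpD hzQ hTz hx₀Q hTx₀ hθ0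
    (by rw [smul_add, smul_inv_smul₀ hθ0.ne', ← add_assoc, add_sub_cancel])
  calc v ≤ φ x + θ * φ (θ⁻¹ • (z - x) + x₀) - θ * v := by linarith
    _ ≤ φ x + θ * C - θ * v := by gcongr
    _ = φ x + (H + 1) / δ * (C - v) * ‖T x‖ := by rw [hθ]; ring

end ExactPenalty

section Multiplier

open Metric

variable {W : Type*} [NormedAddCommGroup W] [InnerProductSpace ℝ W]

lemma exists_mem_closedBall_inner_eq {K : ℝ} (hK : 0 ≤ K) (u : W) :
    ∃ y ∈ closedBall (0 : W) K, ⟪y, u⟫ = K * ‖u‖ := by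
  rcases eq_or_ne u 0 with rfl | hu
  · exact ⟨0, mem_closedBall_self hK, by simp⟩
  have hu' : ‖u‖ ≠ 0 := norm_ne_zero_iff.2 hu
  refine ⟨(K / ‖u‖) • u, ?_, ?_⟩
  · rw [mem_closedBall_zero_iff, norm_smul, norm_div, norm_norm, Real.norm_of_nonneg hK,
      div_mul_cancel₀ _ hu']
  · rw [real_inner_smul_left, real_inner_self_eq_norm_sq]
    field_simp

/-- Minimax for the affine functions `q ↦ q.2 + ⟪y, q.1⟫` with `y` in the ball of radius `K`, whose
maximum is `q.2 + K * ‖q.1‖`. -/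
theorem exists_forall_le_add_inner_of_convex [FiniteDimensional ℝ W] {Γ : Set (W × ℝ)}
    (hΓ : Convex ℝ Γ) {v K : ℝ} (hK0 : 0 ≤ K) (hK : ∀ q ∈ Γ, v ≤ q.2 + K * ‖q.1‖) :
    ∃ y : W, ∀ q ∈ Γ, v ≤ q.2 + ⟪y, q.1⟫ := by
  let ℓ : W → W × ℝ → ℝ := fun y q => -⟪y, q.1⟫ + -q.2
  have hmono : Monotone Real.toEReal := EReal.coe_strictMono.monotone
  have hne : (closedBall (0 : W) K).Nonempty := nonempty_closedBall.2 hK0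
  have hcpt : IsCompact (closedBall (0 : W) K) := isCompact_closedBall _ _
  have hconvex : ∀ q, ConvexOn ℝ (closedBall 0 K) fun y => ℓ y q := fun q =>
    ((-(innerₗ W).flip q.1).convexOn (convex_closedBall 0 K)).add_const (-q.2)
  have hconcave : ∀ y, ConcaveOn ℝ Γ (ℓ y) := fun y =>
    (-(innerₗ W y) ∘ₗ LinearMap.fst ℝ W ℝ + -LinearMap.snd ℝ W ℝ).concaveOn hΓ
  have hlsc : ∀ q ∈ Γ, LowerSemicontinuousOn (fun y => (ℓ y q : EReal)) (closedBall 0 K) :=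
    fun q _ => (continuous_coe_real_ereal.comp
      (by fun_prop : Continuous fun y => ℓ y q)).lowerSemicontinuous.lowerSemicontinuousOn _
  have husc : ∀ y ∈ closedBall (0 : W) K, UpperSemicontinuousOn (fun q => (ℓ y q : EReal)) Γ :=
    fun y _ => (continuous_coe_real_ereal.comp
      (by fun_prop : Continuous (ℓ y))).upperSemicontinuous.upperSemicontinuousOn _
  have hbest : ∀ q ∈ Γ, ∃ y ∈ closedBall (0 : W) K, ℓ y q ≤ -v := fun q hq => by
    obtain ⟨y, hy, hyq⟩ := exists_mem_closedBall_inner_eq hK0 q.1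
    exact ⟨y, hy, by linarith [hK q hq]⟩
  obtain ⟨y, -, hmin⟩ := (lowerSemicontinuousOn_biSup hlsc).exists_isMinOn hne hcpt
  have hy : ⨆ q ∈ Γ, (ℓ y q : EReal) ≤ ((-v : ℝ) : EReal) :=
    calc ⨆ q ∈ Γ, (ℓ y q : EReal) ≤ ⨅ y ∈ closedBall 0 K, ⨆ q ∈ Γ, (ℓ y q : EReal) := le_iInf₂ hmin
      _ = ⨆ q ∈ Γ, ⨅ y ∈ closedBall 0 K, (ℓ y q : EReal) :=
        Sion.minimax' hne (convex_closedBall 0 K) hcpt hlsc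
          (fun q _ => (hconvex q).quasiconvexOn.monotone_comp (g := Real.toEReal) hmono) hΓ husc
          (fun y _ => (hconcave y).quasiconcaveOn.monotone_comp (g := Real.toEReal) hmono)
      _ ≤ ((-v : ℝ) : EReal) := iSup₂_le fun q hq =>
        let ⟨z, hz, hzq⟩ := hbest q hq
        (iInf₂_le z hz).trans (EReal.coe_le_coe_iff.2 hzq)
  refine ⟨y, fun q hq => ?_⟩
  have hyq : (ℓ y q : EReal) ≤ ((-v : ℝ) : EReal) :=
    (le_iSup₂ (f := fun q (_ : q ∈ Γ) => (ℓ y q : EReal)) q hq).trans hy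
  linarith [EReal.coe_le_coe_iff.1 hyq]

theorem exists_multiplier_of_exact_penalty {E : Type*} [AddCommGroup E] [Module ℝ E]
    [FiniteDimensional ℝ W] {C : Set E} {φ : E → ℝ} (hφ : ConvexOn ℝ C φ) (T : E →ᵃ[ℝ] W)
    {v K : ℝ} (hK0 : 0 ≤ K) (hK : ∀ x ∈ C, v ≤ φ x + K * ‖T x‖) :
    ∃ y : W, ∀ x ∈ C, v ≤ φ x + ⟪y, T x⟫ := by
  obtain ⟨y, hy⟩ := exists_forall_le_add_inner_of_convex (v := v)
    (hφ.convex_epigraph.affine_image (T.prodMap (AffineMap.id ℝ ℝ))) hK0 (by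
      rintro _ ⟨⟨x, t⟩, ⟨hx, ht : φ x ≤ t⟩, rfl⟩
      have hxt : v ≤ t + K * ‖T x‖ := (hK x hx).trans (by gcongr)
      exact hxt)
  exact ⟨y, fun x hx => hy (T x, φ x) ⟨(x, φ x), ⟨hx, le_rfl⟩, rfl⟩⟩

end Multiplier

section ExcessiveGap

open Filter Topology

lemma le_of_forall_one_sub_mul_le {N a : ℝ} (h : ∀ t ∈ Set.Ioo (0 : ℝ) 1, (1 - t) * N ≤ a) :
    N ≤ a := by
  have hlim : Tendsto (fun t : ℝ => (1 - t) * N) (𝓝[>] 0) (𝓝 ((1 - 0) * N)) :=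
    (Continuous.tendsto (by fun_prop) 0).mono_left nhdsWithin_le_nhds
  rw [sub_zero, one_mul] at hlim
  exact le_of_tendsto hlim (eventually_of_mem (Ioo_mem_nhdsGT one_pos) h)

variable {E W : Type*} [AddCommGroup E] [Module ℝ E] [NormedAddCommGroup W]
  [InnerProductSpace ℝ W]

lemma norm_sq_smul_add_smul {a c : ℝ} (hac : a + c = 1) (u v : W) :
    ‖a • u + c • v‖ ^ 2 = a * ‖u‖ ^ 2 + c * ‖v‖ ^ 2 - a * c * ‖u - v‖ ^ 2 := by
  obtain rfl : c = 1 - a := by linarith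
  rw [norm_add_sq_real, norm_sub_sq_real, norm_smul, norm_smul, mul_pow, mul_pow,
    real_inner_smul_left, real_inner_smul_right, Real.norm_eq_abs, Real.norm_eq_abs, sq_abs, sq_abs]
  ring

lemma neg_inner_le_div_add_mul {c : ℝ} (hc : 0 < c) (e u : W) :
    -⟪e, u⟫ ≤ ‖e‖ ^ 2 / (2 * c) + c / 2 * ‖u‖ ^ 2 := by
  have hsq : 0 ≤ ‖e + c • u‖ ^ 2 / (2 * c) := by positivity
  rw [norm_add_sq_real, norm_smul, real_inner_smul_right, Real.norm_of_nonneg hc.le] at hsq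
  have hexpand : (‖e‖ ^ 2 + 2 * (c * ⟪e, u⟫) + (c * ‖u‖) ^ 2) / (2 * c) =
      ‖e‖ ^ 2 / (2 * c) + ⟪e, u⟫ + c / 2 * ‖u‖ ^ 2 := by
    field_simp
  linarith

variable {C : Set E} {φ d F : E → ℝ} {T : E →ᵃ[ℝ] W} {x xo xs z : E} {y w : W}
  {L γ γ' β τ c D : ℝ}

lemma add_mul_norm_sub_sq_le_of_isMinOn (hF : ConvexOn ℝ C fun x => F x - c * ‖T x‖ ^ 2)
    (hx : x ∈ C) (hmin : IsMinOn F C x) (hz : z ∈ C) :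
    F x + c * ‖T z - T x‖ ^ 2 ≤ F z := by
  suffices h : c * ‖T z - T x‖ ^ 2 ≤ F z - F x by linarith
  refine le_of_forall_one_sub_mul_le fun t ⟨ht0, ht1⟩ => ?_
  have ht : 0 ≤ 1 - t := by linarith
  have hsum : t + (1 - t) = 1 := by ring
  have hle : F x ≤ F (t • z + (1 - t) • x) := hmin (hF.1 hz hx ht0.le ht hsum)
  have hconv := hF.2 hz hx ht0.le ht hsum
  simp only [smul_eq_mul, Convex.combo_affine_apply (f := T) hsum, norm_sq_smul_add_smul hsum]
    at hconv
  refine le_of_mul_le_mul_left ?_ ht0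
  linarith

/-- The Lagrangian `φ x + ⟪y, T x⟫` for the constraint `T x = 0`, smoothed by `γ` times the
prox-function `d`. -/
def smoothedLagrangian (φ d : E → ℝ) (T : E →ᵃ[ℝ] W) (γ : ℝ) (y : W) (x : E) : ℝ :=
  φ x + ⟪y, T x⟫ + γ * d x

lemma convexOn_smoothedLagrangian_sub (hφ : ConvexOn ℝ C φ)
    (hd : ConvexOn ℝ C fun x => d x - 1 / (2 * L) * ‖T x‖ ^ 2) (hγ : 0 ≤ γ) (y : W) :
    ConvexOn ℝ C fun x => smoothedLagrangian φ d T γ y x - γ / (2 * L) * ‖T x‖ ^ 2 := by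
  have hlin : ConvexOn ℝ C fun x => ⟪y, T x⟫ :=
    (((innerₗ W y).convexOn convex_univ).comp_affineMap T).subset (Set.subset_univ _) hφ.1
  refine ((hφ.add hlin).add (hd.smul hγ)).congr fun x _ => ?_
  simp only [smoothedLagrangian, Pi.add_apply, smul_eq_mul]
  ring

theorem smoothedLagrangian_add_inner_sub_le (hφ : ConvexOn ℝ C φ) (hL : 0 < L)
    (hd : ConvexOn ℝ C fun x => d x - 1 / (2 * L) * ‖T x‖ ^ 2) (hγ : 0 < γ) (hx : x ∈ C)
    (hmin : IsMinOn (smoothedLagrangian φ d T γ y) C x) (e : W) (hz : z ∈ C) :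
    smoothedLagrangian φ d T γ y x + ⟪e, T x⟫ - L / (2 * γ) * ‖e‖ ^ 2 ≤
      smoothedLagrangian φ d T γ (y + e) z := by
  have hgrowth := add_mul_norm_sub_sq_le_of_isMinOn
    (convexOn_smoothedLagrangian_sub hφ hd hγ.le y) hx hmin hz
  have hyoung := neg_inner_le_div_add_mul (div_pos hγ hL) e (T z - T x)
  have hcoef : ‖e‖ ^ 2 / (2 * (γ / L)) = L / (2 * γ) * ‖e‖ ^ 2 := by field_simp
  have hcoef' : γ / L / 2 = γ / (2 * L) := by field_simp
  have hshift : smoothedLagrangian φ d T γ (y + e) z =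
      smoothedLagrangian φ d T γ y z + ⟪e, T z⟫ := by
    simp only [smoothedLagrangian, inner_add_left]
    ring
  rw [hcoef, hcoef', inner_sub_right] at hyoung
  linarith

/-- Nesterov's excessive gap condition: the penalized objective `φ + ‖T ·‖² / (2β)`, an upper
smoothing of the primal function, is at `x` at most the smoothed dual function
`y ↦ inf (smoothedLagrangian φ d T γ y)` at `y`. The infimum over `C` is written out as a lower
bound, so that it need not be attained. -/
def ExcessiveGap (C : Set E) (φ d : E → ℝ) (T : E →ᵃ[ℝ] W) (γ β : ℝ) (x : E) (y : W) : Prop :=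
  x ∈ C ∧ ∀ z ∈ C, φ x + ‖T x‖ ^ 2 / (2 * β) ≤ smoothedLagrangian φ d T γ y z

theorem excessiveGap_of_isMinOn_smoothedLagrangian_zero (hφ : ConvexOn ℝ C φ) (hL : 0 < L)
    (hd : ConvexOn ℝ C fun x => d x - 1 / (2 * L) * ‖T x‖ ^ 2) (hγ : 0 < γ) (hβ : 0 < β)
    (hγβ : γ * β = L) (hx : x ∈ C) (hdx : 0 ≤ d x)
    (hmin : IsMinOn (smoothedLagrangian φ d T γ 0) C x) :
    ExcessiveGap C φ d T γ β x (β⁻¹ • T x) := by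
  refine ⟨hx, fun z hz => ?_⟩
  have hmodel := smoothedLagrangian_add_inner_sub_le hφ hL hd hγ hx hmin (β⁻¹ • T x) hz
  have hmodel_eq : smoothedLagrangian φ d T γ 0 x + ⟪β⁻¹ • T x, T x⟫ -
      L / (2 * γ) * ‖β⁻¹ • T x‖ ^ 2 = φ x + ‖T x‖ ^ 2 / (2 * β) + γ * d x := by
    rw [smoothedLagrangian, inner_zero_left, real_inner_smul_left, real_inner_self_eq_norm_sq,
      norm_smul, norm_inv, Real.norm_of_nonneg hβ.le, ← hγβ]
    field_simp
    ring
  rw [hmodel_eq, zero_add] at hmodel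
  linarith [mul_nonneg hγ.le hdx]

theorem excessiveGap_of_isMinOn_proxStep {q : E → ℝ} (hγ : 0 < γ) (hβ : 0 < β)
    (hγβ : γ * β = L) (hqd : ∀ z ∈ C, q z / 2 ≤ d z) (hx : x ∈ C)
    (hqx : ‖T x - w‖ ^ 2 ≤ L * q x)
    (hmin : IsMinOn (fun z => φ z + ⟪β⁻¹ • w, T z - w⟫ + L / (2 * β) * q z) C x) :
    ExcessiveGap C φ d T γ β x (β⁻¹ • w) := by
  refine ⟨hx, fun z hz => ?_⟩
  have hz_min : φ x + ⟪β⁻¹ • w, T x - w⟫ + L / (2 * β) * q x ≤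
      φ z + ⟪β⁻¹ • w, T z - w⟫ + L / (2 * β) * q z := hmin hz
  have hcoef : L / (2 * β) * q z = γ * (q z / 2) := by rw [← hγβ]; field_simp
  have hsq : ‖T x‖ ^ 2 / (2 * β) =
      ‖T x - w‖ ^ 2 / (2 * β) + ⟪β⁻¹ • w, T x - w⟫ + ‖w‖ ^ 2 / (2 * β) := by
    rw [inner_sub_right, real_inner_smul_left, real_inner_smul_left, norm_sub_sq_real,
      real_inner_comm, real_inner_self_eq_norm_sq]
    field_simp
    ring
  have hres : ‖T x - w‖ ^ 2 / (2 * β) ≤ L / (2 * β) * q x := by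
    rw [div_mul_eq_mul_div]
    gcongr
  have hw : ⟪β⁻¹ • w, T z - w⟫ = ⟪β⁻¹ • w, T z⟫ - ‖w‖ ^ 2 / (2 * β) - ‖w‖ ^ 2 / (2 * β) := by
    rw [inner_sub_right, real_inner_smul_left _ w, real_inner_self_eq_norm_sq]
    field_simp
    ring
  have hprox := mul_le_mul_of_nonneg_left (hqd z hz) hγ.le
  have hw_nonneg : 0 ≤ ‖w‖ ^ 2 / (2 * β) := by positivity
  rw [smoothedLagrangian]
  linarith

theorem ExcessiveGap.step (hφ : ConvexOn ℝ C φ) (hL : 0 < L)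
    (hd : ConvexOn ℝ C fun x => d x - 1 / (2 * L) * ‖T x‖ ^ 2) (hγ' : 0 < γ') (hβ : 0 < β)
    (hτ0 : 0 ≤ τ) (hτ1 : τ < 1) (hγγ' : (1 - τ) * γ ≤ γ') (hτ : L * τ ^ 2 ≤ (1 - τ) * β * γ')
    (hgap : ExcessiveGap C φ d T γ β x y) (hxs : xs ∈ C) (hdxs : 0 ≤ d xs)
    (hmin : IsMinOn (smoothedLagrangian φ d T γ' ((1 - τ) • y + τ • (β⁻¹ • T x))) C xs) :
    ExcessiveGap C φ d T γ' ((1 - τ) * β) ((1 - τ) • x + τ • xs)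
      ((1 - τ) • y + τ • (β⁻¹ • T x) + (γ' / L) • T xs) := by
  have hτ' : 0 < 1 - τ := by linarith
  have hsum : 1 - τ + τ = 1 := by ring
  refine ⟨hφ.1 hgap.1 hxs hτ'.le hτ0 hsum, fun z hz => ?_⟩
  refine le_trans ?_ (smoothedLagrangian_add_inner_sub_le hφ hL hd hγ' hxs hmin _ hz)
  have hconv : φ ((1 - τ) • x + τ • xs) ≤ (1 - τ) * φ x + τ * φ xs :=
    hφ.2 hgap.1 hxs hτ'.le hτ0 hsum
  have hold := mul_le_mul_of_nonneg_left (hgap.2 xs hxs) hτ'.le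
  have hprox := mul_le_mul_of_nonneg_right hγγ' hdxs
  have hpenalty : ‖(1 - τ) • T x + τ • T xs‖ ^ 2 / (2 * ((1 - τ) * β)) =
      (1 - τ) * (‖T x‖ ^ 2 / (2 * β)) + τ * (β⁻¹ * ⟪T x, T xs⟫) +
        τ ^ 2 / (2 * ((1 - τ) * β)) * ‖T xs‖ ^ 2 := by
    rw [norm_add_sq_real, norm_smul, norm_smul, real_inner_smul_left, real_inner_smul_right,
      Real.norm_of_nonneg hτ'.le, Real.norm_of_nonneg hτ0]
    field_simp
  have hcoef : τ ^ 2 / (2 * ((1 - τ) * β)) * ‖T xs‖ ^ 2 ≤ γ' / (2 * L) * ‖T xs‖ ^ 2 := by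
    refine mul_le_mul_of_nonneg_right ?_ (sq_nonneg _)
    rw [div_le_div_iff₀ (by positivity) (by positivity)]
    linarith
  have hgain : ⟪(γ' / L) • T xs, T xs⟫ - L / (2 * γ') * ‖(γ' / L) • T xs‖ ^ 2 =
      γ' / (2 * L) * ‖T xs‖ ^ 2 := by
    rw [real_inner_smul_left, real_inner_self_eq_norm_sq, norm_smul,
      Real.norm_of_nonneg (by positivity)]
    field_simp
    ring
  rw [Convex.combo_affine_apply (f := T) hsum, hpenalty, add_sub_assoc, hgain, smoothedLagrangian,
    inner_add_left, real_inner_smul_left, real_inner_smul_left, real_inner_smul_left]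
  rw [smoothedLagrangian] at hold
  linarith

lemma ExcessiveGap.add_sq_div_le (hgap : ExcessiveGap C φ d T γ β x y) (hxo : xo ∈ C)
    (hTxo : T xo = 0) : φ x + ‖T x‖ ^ 2 / (2 * β) ≤ φ xo + γ * d xo := by
  simpa only [smoothedLagrangian, hTxo, inner_zero_right, add_zero] using hgap.2 xo hxo

lemma ExcessiveGap.sub_le (hgap : ExcessiveGap C φ d T γ β x y) (hβ : 0 ≤ β) (hγ : 0 ≤ γ)
    (hxo : xo ∈ C) (hTxo : T xo = 0) (hdxo : d xo ≤ D) : φ x - φ xo ≤ γ * D := by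
  have hpenalty : 0 ≤ ‖T x‖ ^ 2 / (2 * β) := by positivity
  linarith [hgap.add_sq_div_le hxo hTxo, mul_le_mul_of_nonneg_left hdxo hγ]

lemma le_add_of_sq_le_mul_add_sq {s a b : ℝ} (ha : 0 ≤ a) (hb : 0 ≤ b)
    (h : s ^ 2 ≤ a * s + b ^ 2) : s ≤ a + b := by
  by_contra! hlt
  nlinarith

theorem ExcessiveGap.norm_le (hgap : ExcessiveGap C φ d T γ β x y) (hβ : 0 < β) (hγ : 0 ≤ γ)
    (hD : 0 ≤ D) (hxo : xo ∈ C) (hTxo : T xo = 0) (hdxo : d xo ≤ D)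
    (hw : φ xo ≤ φ x + ⟪w, T x⟫) : ‖T x‖ ≤ 2 * β * ‖w‖ + √(2 * β * γ * D) := by
  refine le_add_of_sq_le_mul_add_sq (by positivity) (Real.sqrt_nonneg _) ?_
  rw [Real.sq_sqrt (by positivity)]
  calc ‖T x‖ ^ 2 = 2 * β * (‖T x‖ ^ 2 / (2 * β)) := by field_simp
    _ ≤ 2 * β * (‖w‖ * ‖T x‖ + γ * D) := by
      have hcs := real_inner_le_norm w (T x)
      have hprox := mul_le_mul_of_nonneg_left hdxo hγ
      gcongr
      linarith [hgap.add_sq_div_le hxo hTxo]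
    _ = 2 * β * ‖w‖ * ‖T x‖ + 2 * β * γ * D := by ring

end ExcessiveGap

section Bregman

open Filter Topology

theorem add_add_le_of_strongConvexOn {E : Type*} [NormedAddCommGroup E] [NormedSpace ℝ E]
    {h : E → ℝ} {K : Set E} {σ h' : ℝ} {u v : E} (hh : StrongConvexOn K σ h) (hu : u ∈ K)
    (hv : v ∈ K) (hder : HasLineDerivAt ℝ h h' v (u - v)) :
    h v + h' + σ / 2 * ‖u - v‖ ^ 2 ≤ h u := by
  have hlim : Tendsto (fun t : ℝ => h u - h v - (1 - t) * (σ / 2 * ‖u - v‖ ^ 2)) (𝓝[>] 0)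
      (𝓝 (h u - h v - (1 - 0) * (σ / 2 * ‖u - v‖ ^ 2))) :=
    (Continuous.tendsto (by fun_prop) 0).mono_left nhdsWithin_le_nhds
  have hslope : ∀ᶠ t : ℝ in 𝓝[>] 0, t⁻¹ • (h (v + t • (u - v)) - h v) ≤
      h u - h v - (1 - t) * (σ / 2 * ‖u - v‖ ^ 2) := by
    filter_upwards [Ioo_mem_nhdsGT (zero_lt_one (α := ℝ))] with t ht
    have hconv := hh.2 hu hv ht.1.le (sub_nonneg.2 ht.2.le) (by ring)
    have hpoint : t • u + (1 - t) • v = v + t • (u - v) := by module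
    rw [hpoint, smul_eq_mul, smul_eq_mul] at hconv
    rw [smul_eq_mul, inv_mul_le_iff₀ ht.1]
    linarith
  linarith [le_of_tendsto_of_tendsto hder.tendsto_slope_zero_right hlim hslope]

variable {d : ℕ} {h : Vec d → ℝ} {K : Set (Vec d)} {σ : ℝ}

theorem IsProxFunction.le_bregman (hh : IsProxFunction h K σ) {u v : Vec d} (hu : u ∈ K)
    (hv : v ∈ K) : σ / 2 * ‖u - v‖ ^ 2 ≤ bregman h u v := by
  have hder := (hh.2.2 v hv).hasGradientAt.hasFDerivAt.hasLineDerivAt (u - v)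
  rw [InnerProductSpace.toDual_apply_apply] at hder
  rw [bregman]
  linarith [add_add_le_of_strongConvexOn hh.2.1 hu hv hder]

theorem strongConvexOn_bregman (hh : StrongConvexOn K σ h) (w : Vec d) :
    StrongConvexOn K σ fun u => bregman h u w := by
  have hlin : ConvexOn ℝ K fun u => -⟪gradient h w, u⟫ :=
    (-(innerₗ _ (gradient h w))).convexOn hh.1
  rw [strongConvexOn_iff_convex] at hh ⊢
  refine ((hh.add hlin).add_const (⟪gradient h w, w⟫ - h w)).congr fun u _ => ?_
  simp only [bregman, inner_sub_right, Pi.add_apply]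
  ring

end Bregman

namespace Problem

variable {m r : ℕ} {n : Fin (r + 1) → ℕ} (P : Problem m r n)

/-- The residual `A x - b` as an affine map. -/
noncomputable def resAffine : Blocks n →ᵃ[ℝ] Vec m where
  toFun := P.res
  linear := ∑ i, Matrix.toEuclideanLin (P.A i) ∘ₗ LinearMap.proj i
  map_vadd' x v := by
    simp only [res, app, vadd_eq_add, Pi.add_apply, map_add, Finset.sum_add_distrib,
      LinearMap.coe_sum, Finset.sum_apply, LinearMap.comp_apply, LinearMap.proj_apply]
    abel

variable {P}

theorem Standing.convex_constraint (hP : P.Standing) : Convex ℝ P.constraint :=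
  fun _ hx _ hz _ _ ha hc hac i => (hP.2.1 i).2.2 (hx i) (hz i) ha hc hac

theorem Standing.convexOn_obj (hP : P.Standing) : ConvexOn ℝ P.domain P.obj := by
  refine ⟨fun x hx z hz a c ha hc hac i => (hP.1 i).2.1.1 (hx i) (hz i) ha hc hac,
    fun x hx z hz a c ha hc hac => ?_⟩
  simp only [obj, Finset.smul_sum]
  rw [← Finset.sum_add_distrib]
  exact Finset.sum_le_sum fun i _ => (hP.1 i).2.1.2 (hx i) (hz i) ha hc hac

theorem Standing.convexOn_obj_inter (hP : P.Standing) :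
    ConvexOn ℝ (P.constraint ∩ P.domain) P.obj :=
  hP.convexOn_obj.subset Set.inter_subset_right (hP.convex_constraint.inter hP.convexOn_obj.1)

theorem optValue_eq {x : Blocks n} (hx : x ∈ P.feasible) (hmin : IsMinOn P.obj P.feasible x) :
    P.optValue = P.obj x :=
  IsLeast.csInf_eq ⟨⟨x, hx, rfl⟩, Set.forall_mem_image.2 fun _ hz => hmin hz⟩

theorem Standing.optValue_le (hP : P.Standing) {x : Blocks n} (hx : x ∈ P.feasible) :
    P.optValue ≤ P.obj x := by
  obtain ⟨xo, hxo, hmin⟩ := hP.2.2.1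
  exact (optValue_eq hxo hmin).trans_le (hmin hx)

theorem Standing.exists_exact_penalty (hP : P.Standing) :
    ∃ K, 0 ≤ K ∧ ∀ x ∈ P.constraint ∩ P.domain, P.optValue ≤ P.obj x + K * ‖P.res x‖ := by
  rcases hP.2.2.2 with ⟨⟨s, hs, hX⟩, x₀, hx₀X, hx₀, hres⟩ | ⟨x₀, hx₀, hres⟩
  · have hT := hasErrorBound_convexHull_inter P.resAffine (affineSpan ℝ P.domain) hs.toFinset
      ⟨by rwa [hs.coe_toFinset, ← hX], subset_affineSpan ℝ _ (intrinsicInterior_subset hx₀)⟩ hres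
    rw [hs.coe_toFinset, ← hX] at hT
    exact exists_exact_penalty_of_hasErrorBound hP.convexOn_obj hP.convex_constraint P.resAffine hT
      hx₀X hx₀ hres fun x hx hx0 => hP.optValue_le ⟨hx, hx0⟩
  · have hT : HasErrorBound (Set.univ ∩ affineSpan ℝ (P.constraint ∩ P.domain)) P.resAffine := by
      rw [Set.univ_inter]
      exact hasErrorBound_affineSubspace P.resAffine _
        (subset_affineSpan ℝ _ (intrinsicInterior_subset hx₀)) hres
    obtain ⟨K, hK0, hK⟩ := exists_exact_penalty_of_hasErrorBound hP.convexOn_obj_inter convex_univ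
      P.resAffine hT (Set.mem_univ x₀) hx₀ hres fun x hx hx0 => hP.optValue_le ⟨hx.2, hx0⟩
    exact ⟨K, hK0, fun x hx => hK x ⟨Set.mem_univ x, hx⟩⟩

theorem Standing.exists_multiplier (hP : P.Standing) :
    ∃ y, ∀ x ∈ P.constraint ∩ P.domain, P.optValue ≤ P.obj x + ⟪y, P.res x⟫ := by
  obtain ⟨K, hK0, hK⟩ := hP.exists_exact_penalty
  exact exists_multiplier_of_exact_penalty hP.convexOn_obj_inter P.resAffine hK0 hK

theorem Standing.mem_dualSolutions_iff (hP : P.Standing) {y : Vec m} :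
    y ∈ P.dualSolutions ↔
      ∀ x ∈ P.constraint ∩ P.domain, P.optValue ≤ P.obj x + ⟪y, P.res x⟫ := by
  have hupper : ∀ z, P.dualFun z ≤ (P.optValue : EReal) := fun z => by
    obtain ⟨xo, hxo, hmin⟩ := hP.2.2.1
    refine (iInf₂_le xo hxo.1).trans ?_
    rw [hxo.2, inner_zero_right, add_zero, optValue_eq hxo hmin]
  have hlower : ∀ z, (P.optValue : EReal) ≤ P.dualFun z ↔
      ∀ x ∈ P.constraint ∩ P.domain, P.optValue ≤ P.obj x + ⟪z, P.res x⟫ := fun z => by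
    simp only [dualFun, le_iInf_iff, EReal.coe_le_coe_iff]
  refine ⟨fun hy => ?_, fun hy z => (hupper z).trans ((hlower y).2 hy)⟩
  obtain ⟨y₀, hy₀⟩ := hP.exists_multiplier
  exact (hlower y).1 (((hlower y₀).2 hy₀).trans (hy y₀))

theorem Standing.isClosed_dualSolutions (hP : P.Standing) : IsClosed P.dualSolutions := by
  have hInter : P.dualSolutions = ⋂ x ∈ P.constraint ∩ P.domain,
      {y | P.optValue ≤ P.obj x + ⟪y, P.res x⟫} := by
    ext y
    simp only [hP.mem_dualSolutions_iff, Set.mem_iInter, Set.mem_ofPred_eq]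
  rw [hInter]
  exact isClosed_biInter fun x _ => isClosed_le continuous_const (by fun_prop)

theorem Standing.isLeast_dualRadius (hP : P.Standing) :
    IsLeast ((fun z => ‖z‖) '' P.dualSolutions) P.dualRadius := by
  have hne : P.dualSolutions.Nonempty :=
    hP.exists_multiplier.imp fun y hy => hP.mem_dualSolutions_iff.2 hy
  obtain ⟨y, hy, hdist⟩ := hP.isClosed_dualSolutions.exists_infDist_eq_dist hne 0
  have hleast : IsLeast ((fun z => ‖z‖) '' P.dualSolutions) ‖y‖ := by
    refine ⟨⟨y, hy, rfl⟩, Set.forall_mem_image.2 fun z hz => ?_⟩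
    simpa only [hdist, dist_zero_left] using Metric.infDist_le_dist_of_mem (x := 0) hz
  rwa [dualRadius, hleast.csInf_eq]

theorem Standing.neg_dualRadius_mul_norm_le (hP : P.Standing) {x : Blocks n}
    (hx : x ∈ P.constraint ∩ P.domain) :
    -P.dualRadius * ‖P.res x‖ ≤ P.obj x - P.optValue := by
  obtain ⟨w, hw, hnorm : ‖w‖ = P.dualRadius⟩ := hP.isLeast_dualRadius.1
  rw [← hnorm]
  linarith [hP.mem_dualSolutions_iff.1 hw x hx, real_inner_le_norm w (P.res x)]

end Problem

namespace Smoother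

variable {m r : ℕ} {n : Fin (r + 1) → ℕ} {P : Problem m r n} {B : Smoother n} {σ L : ℝ}
  {x z : Blocks n}

lemma normSqS_sub (x z : Blocks n) : B.normSqS (x - z) =
    (∑ i : Fin r, ‖app (B.S i) (x i.castSucc) - app (B.S i) (z i.castSucc)‖ ^ 2) +
      ‖x (Fin.last r) - z (Fin.last r)‖ ^ 2 := by
  simp only [normSqS, app, Pi.sub_apply, map_sub]

theorem IsSmoother.le_dist (hB : B.IsSmoother P σ) (hx : x ∈ P.constraint)
    (hz : z ∈ P.constraint) : σ / 2 * B.normSqS (x - z) ≤ B.dist x z := by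
  rw [normSqS_sub, dist, mul_add, Finset.mul_sum]
  exact add_le_add (Finset.sum_le_sum fun i _ => (hB.2.1 i).le_bregman
    (Set.mem_image_of_mem _ (hx _)) (Set.mem_image_of_mem _ (hz _)))
    (hB.2.2.le_bregman (hx _) (hz _))

theorem IsSmoothingConstant.norm_sq_le (hL : B.IsSmoothingConstant P σ L) (hx : x ∈ P.constraint)
    (hz : z ∈ P.constraint) :
    1 / (2 * L) * ‖P.res x - P.res z‖ ^ 2 ≤ σ / 2 * B.normSqS (x - z) := by
  have hL0 := hL.1
  calc 1 / (2 * L) * ‖P.res x - P.res z‖ ^ 2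
      ≤ 1 / (2 * L) * (σ * L * B.normSqS (x - z)) := by
        gcongr
        exact hL.2 x hx z hz
    _ = σ / 2 * B.normSqS (x - z) := by field_simp

theorem IsSmoother.dist_nonneg (hB : B.IsSmoother P σ) (hL : B.IsSmoothingConstant P σ L)
    (hx : x ∈ P.constraint) (hz : z ∈ P.constraint) : 0 ≤ B.dist x z := by
  have hL0 := hL.1
  calc 0 ≤ 1 / (2 * L) * ‖P.res x - P.res z‖ ^ 2 := by positivity
    _ ≤ σ / 2 * B.normSqS (x - z) := hL.norm_sq_le hx hz
    _ ≤ B.dist x z := hB.le_dist hx hz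

theorem IsSmoother.proxDiameter_nonneg (hB : B.IsSmoother P σ)
    (hL : B.IsSmoothingConstant P σ L) : 0 ≤ B.proxDiameter P :=
  Real.sSup_nonneg fun _ ⟨_, hx, _, hz, h⟩ => h ▸ hB.dist_nonneg hL hx hz

theorem dist_le_proxDiameter (hD : BddAbove (B.proxValues P)) (hx : x ∈ P.constraint)
    (hz : z ∈ P.constraint) : B.dist x z ≤ B.proxDiameter P :=
  le_csSup hD ⟨x, hx, z, hz, rfl⟩

theorem IsSmoother.dist_smul_add_smul_le (hB : B.IsSmoother P σ) (w : Blocks n)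
    (hx : x ∈ P.constraint) (hz : z ∈ P.constraint) {a c : ℝ} (ha : 0 ≤ a) (hc : 0 ≤ c)
    (hac : a + c = 1) : B.dist (a • x + c • z) w ≤
      a * B.dist x w + c * B.dist z w - a * c * (σ / 2 * B.normSqS (x - z)) := by
  have hblocks := Finset.sum_le_sum fun i (_ : i ∈ (Finset.univ : Finset (Fin r))) =>
    (strongConvexOn_bregman (hB.2.1 i).2.1 (app (B.S i) (w i.castSucc))).2
      (Set.mem_image_of_mem _ (hx i.castSucc)) (Set.mem_image_of_mem _ (hz i.castSucc)) ha hc hac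
  have hlast := (strongConvexOn_bregman hB.2.2.2.1 (w (Fin.last r))).2 (hx _) (hz _) ha hc hac
  simp only [smul_eq_mul, Finset.sum_sub_distrib, Finset.sum_add_distrib, ← Finset.mul_sum]
    at hblocks hlast
  rw [normSqS_sub]
  simp only [dist, app, Pi.add_apply, Pi.smul_apply, map_add, map_smul] at hblocks ⊢
  linarith

theorem IsSmoother.convexOn_dist_sub (hP : P.Standing) (hB : B.IsSmoother P σ)
    (hL : B.IsSmoothingConstant P σ L) (w : Blocks n) :
    ConvexOn ℝ P.constraint fun x => B.dist x w - 1 / (2 * L) * ‖P.resAffine x‖ ^ 2 := by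
  refine ⟨hP.convex_constraint, fun x hx z hz a c ha hc hac => ?_⟩
  have hdist := hB.dist_smul_add_smul_le w hx hz ha hc hac
  have hres : 1 / (2 * L) * ‖P.resAffine x - P.resAffine z‖ ^ 2 ≤ σ / 2 * B.normSqS (x - z) :=
    hL.norm_sq_le hx hz
  have hmul := mul_le_mul_of_nonneg_left hres (mul_nonneg ha hc)
  simp only [Convex.combo_affine_apply (f := P.resAffine) hac, norm_sq_smul_add_smul hac,
    smul_eq_mul]
  linarith

end Smoother

section Parameters

variable (L : ℝ) (k : ℕ)

lemma gam_eq : gam L k = 2 * √L / ((k : ℝ) + 2) := by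
  induction k with
  | zero => simp [gam]
  | succ k ih =>
    have hk : (k : ℝ) + 2 + 1 ≠ 0 := by positivity
    rw [gam, ih, tau]
    push_cast
    field_simp
    ring

lemma bet_eq : bet L k = √L / ((k : ℝ) + 1) := by
  induction k with
  | zero => simp [bet]
  | succ k ih =>
    rw [bet, ih, tau]
    push_cast
    field_simp
    ring

lemma tau_pos : 0 < tau k := by rw [tau]; positivity

lemma tau_lt_one : tau k < 1 := by
  rw [tau, div_lt_one (by positivity)]
  linarith [k.cast_nonneg (α := ℝ)]

lemma gam_nonneg : 0 ≤ gam L k := by rw [gam_eq]; positivity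

lemma one_sub_tau_mul_gam_le : (1 - tau k) * gam L k ≤ gam L (k + 1) := by
  rw [gam]
  have hτ : tau k / (1 + tau k) ≤ tau k := div_le_self (tau_pos k).le (by linarith [tau_pos k])
  exact mul_le_mul_of_nonneg_right (by linarith) (gam_nonneg L k)

variable {L}

lemma gam_pos (hL : 0 < L) : 0 < gam L k := by rw [gam_eq]; positivity

lemma bet_pos (hL : 0 < L) : 0 < bet L k := by rw [bet_eq]; positivity

lemma mul_tau_sq_le (hL : 0 ≤ L) : L * tau k ^ 2 ≤ (1 - tau k) * bet L k * gam L (k + 1) := by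
  calc L * tau k ^ 2 = √L ^ 2 * (1 / ((k : ℝ) + 2) ^ 2) := by
        rw [Real.sq_sqrt hL, tau, div_pow, one_pow]
    _ ≤ √L ^ 2 * (2 / (((k : ℝ) + 2) * (k + 3))) := by
        refine mul_le_mul_of_nonneg_left ?_ (sq_nonneg _)
        rw [div_le_div_iff₀ (by positivity) (by positivity)]
        nlinarith [k.cast_nonneg (α := ℝ)]
    _ = bet L (k + 1) * gam L (k + 1) := by
        rw [bet_eq, gam_eq]
        push_cast
        field_simp
        ring

lemma two_mul_bet_le (hL : 0 ≤ L) : 2 * bet L k ≤ 2 * √(2 * L) / ((k : ℝ) + 1) := by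
  rw [bet_eq, ← mul_div_assoc]
  gcongr
  linarith

lemma gam_le (hL : 0 ≤ L) : gam L k ≤ 2 * √(2 * L) / ((k : ℝ) + 1) := by
  rw [gam_eq]
  gcongr <;> linarith

lemma sqrt_bet_mul_gam_mul_le (hL : 0 ≤ L) (D : ℝ) :
    √(2 * bet L k * gam L k * D) ≤ 2 * √(2 * L) / ((k : ℝ) + 1) * √D := by
  have hprod : 2 * bet L k * gam L k ≤ (2 * √(2 * L) / ((k : ℝ) + 1)) ^ 2 := by
    rw [sq]
    exact mul_le_mul (two_mul_bet_le k hL) (gam_le k hL) (gam_nonneg L k) (by positivity)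
  have hprod_nonneg : 0 ≤ 2 * bet L k * gam L k := by
    rw [bet_eq, gam_eq]
    positivity
  rw [Real.sqrt_mul hprod_nonneg]
  exact mul_le_mul_of_nonneg_right (Real.sqrt_le_iff.2 ⟨by positivity, hprod⟩) (Real.sqrt_nonneg D)

end Parameters

namespace Smoother

variable {m r : ℕ} {n : Fin (r + 1) → ℕ} {P : Problem m r n} {B : Smoother n} {σ L : ℝ}

theorem IsStart.excessiveGap (hP : P.Standing) (hB : B.IsSmoother P σ)
    (hL : B.IsSmoothingConstant P σ L) {x₀ : Blocks n} {y₀ : Vec m}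
    (hstart : B.IsStart P σ L x₀ y₀) :
    ExcessiveGap (P.constraint ∩ P.domain) P.obj (fun z => B.dist z B.center) P.resAffine
      (gam L 0) (bet L 0) x₀ y₀ := by
  have hγ := gam_pos 0 hL.1
  have hβ := bet_pos 0 hL.1
  have hγβ : gam L 0 * bet L 0 = L := Real.mul_self_sqrt hL.1.le
  rcases hstart with ⟨⟨hx₀, hmin⟩, rfl⟩ | ⟨rfl, rfl, hx₀, hmin⟩
  · exact excessiveGap_of_isMinOn_smoothedLagrangian_zero hP.convexOn_obj_inter hL.1
      ((hB.convexOn_dist_sub hP hL B.center).subset Set.inter_subset_left hP.convexOn_obj_inter.1)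
      hγ hβ hγβ hx₀ (hB.dist_nonneg hL hx₀.1 hB.1) hmin
  · refine excessiveGap_of_isMinOn_proxStep hγ hβ hγβ (fun z hz => ?_) hx₀
      ((hL.2 x₀ hx₀.1 B.center hB.1).trans_eq (by rw [one_mul])) hmin
    linarith [hB.le_dist hz.1 hB.1]

theorem IsGenerated.excessiveGap (hP : P.Standing) (hB : B.IsSmoother P σ)
    (hL : B.IsSmoothingConstant P σ L) {x : ℕ → Blocks n} {y : ℕ → Vec m}
    (hxy : B.IsGenerated P σ L x y) (k : ℕ) :
    ExcessiveGap (P.constraint ∩ P.domain) P.obj (fun z => B.dist z B.center) P.resAffine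
      (gam L k) (bet L k) (x k) (y k) := by
  induction k with
  | zero => exact hxy.1.excessiveGap hP hB hL
  | succ k ih =>
    obtain ⟨xs, ⟨hxs, hmin⟩, hx, hy⟩ := hxy.2 k
    rw [hx, hy]
    exact ih.step hP.convexOn_obj_inter hL.1
      ((hB.convexOn_dist_sub hP hL B.center).subset Set.inter_subset_left hP.convexOn_obj_inter.1)
      (gam_pos (k + 1) hL.1) (bet_pos k hL.1) (tau_pos k).le (tau_lt_one k)
      (one_sub_tau_mul_gam_le L k) (mul_tau_sq_le k hL.1.le) hxs
      (hB.dist_nonneg hL hxs.1 hB.1) hmin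

theorem IsGenerated.norm_res_le (hP : P.Standing) (hB : B.IsSmoother P σ)
    (hD : BddAbove (B.proxValues P)) (hL : B.IsSmoothingConstant P σ L) {x : ℕ → Blocks n}
    {y : ℕ → Vec m} (hxy : B.IsGenerated P σ L x y) (k : ℕ) :
    ‖P.res (x k)‖ ≤
      2 * √(2 * L) * (P.dualRadius + √(B.proxDiameter P)) / ((k : ℝ) + 1) := by
  obtain ⟨w, hw, hnorm : ‖w‖ = P.dualRadius⟩ := hP.isLeast_dualRadius.1
  obtain ⟨xo, hxo, hopt⟩ := hP.2.2.1
  have hgap := hxy.excessiveGap hP hB hL k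
  have hlower := hP.mem_dualSolutions_iff.1 hw (x k) hgap.1
  rw [Problem.optValue_eq hxo hopt] at hlower
  rw [← hnorm]
  calc ‖P.res (x k)‖
      ≤ 2 * bet L k * ‖w‖ + √(2 * bet L k * gam L k * B.proxDiameter P) :=
        hgap.norm_le (bet_pos k hL.1) (gam_nonneg L k) (hB.proxDiameter_nonneg hL) hxo.1 hxo.2
          (dist_le_proxDiameter hD hxo.1.1 hB.1) hlower
    _ ≤ 2 * √(2 * L) / ((k : ℝ) + 1) * ‖w‖ +
          2 * √(2 * L) / ((k : ℝ) + 1) * √(B.proxDiameter P) :=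
        add_le_add (mul_le_mul_of_nonneg_right (two_mul_bet_le k hL.1.le) (norm_nonneg w))
          (sqrt_bet_mul_gam_mul_le k hL.1.le _)
    _ = 2 * √(2 * L) * (‖w‖ + √(B.proxDiameter P)) / ((k : ℝ) + 1) := by ring

theorem IsGenerated.obj_sub_optValue_le (hP : P.Standing) (hB : B.IsSmoother P σ)
    (hD : BddAbove (B.proxValues P)) (hL : B.IsSmoothingConstant P σ L) {x : ℕ → Blocks n}
    {y : ℕ → Vec m} (hxy : B.IsGenerated P σ L x y) (k : ℕ) :
    P.obj (x k) - P.optValue ≤ 2 * √(2 * L) / ((k : ℝ) + 1) * B.proxDiameter P := by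
  obtain ⟨xo, hxo, hopt⟩ := hP.2.2.1
  rw [Problem.optValue_eq hxo hopt]
  exact ((hxy.excessiveGap hP hB hL k).sub_le (bet_pos k hL.1).le (gam_nonneg L k) hxo.1 hxo.2
    (dist_le_proxDiameter hD hxo.1.1 hB.1)).trans
    (mul_le_mul_of_nonneg_right (gam_le k hL.1.le) (hB.proxDiameter_nonneg hL))

end Smoother

end SepConvex

theorem corollary5p2_general {m r : ℕ} {n : Fin (r + 1) → ℕ}
    (P : SepConvex.Problem m r n) (hP : P.Standing)
    (B : SepConvex.Smoother n) (σ : ℝ) (hB : B.IsSmoother P σ)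
    (hD : BddAbove (B.proxValues P))
    (L : ℝ) (hL : B.IsSmoothingConstant P σ L)
    (x : ℕ → SepConvex.Blocks n) (y : ℕ → SepConvex.Vec m)
    (hxy : B.IsGenerated P σ L x y) :
    IsLeast ((fun z => ‖z‖) '' P.dualSolutions) P.dualRadius ∧
    ∀ k : ℕ,
      x k ∈ P.constraint ∩ P.domain ∧
      ‖P.res (x k)‖ ≤
        2 * √(2 * L) * (P.dualRadius + √(B.proxDiameter P)) / ((k : ℝ) + 1) ∧
      -P.dualRadius * ‖P.res (x k)‖ ≤ P.obj (x k) - P.optValue ∧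
      P.obj (x k) - P.optValue ≤ 2 * √(2 * L) / ((k : ℝ) + 1) * B.proxDiameter P := by
  refine ⟨hP.isLeast_dualRadius, fun k => ?_⟩
  have hmem : x k ∈ P.constraint ∩ P.domain := (hxy.excessiveGap hP hB hL k).1
  exact ⟨hmem, hxy.norm_res_le hP hB hD hL k, hP.neg_dualRadius_mul_norm_le hmem,
    hxy.obj_sub_optValue_le hP hB hD hL k⟩

theorem corollary5p2 {m r : ℕ} {n : Fin (r + 1) → ℕ}
    (P : SepConvex.Problem m r n) (hP : P.Standing)
    (B : SepConvex.Smoother n) (σ : ℝ) (hσ : 0 < σ) (hB : B.IsSmoother P σ)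
    (Lf : NNReal)
    (hdom : P.dom (Fin.last r) = Set.univ)
    (hf : SepConvex.IsLipschitzGradient Lf (P.f (Fin.last r)))
    (hA : ∀ μ ∈ spectrum ℝ ((P.A (Fin.last r)).transpose * P.A (Fin.last r)), 0 < μ)
    (hh : SepConvex.IsLipschitzGradient 1 B.hLast)
    (hD : BddAbove (B.proxValues P))
    (L : ℝ) (hL : B.IsSmoothingConstant P σ L)
    (x : ℕ → SepConvex.Blocks n) (y : ℕ → SepConvex.Vec m)
    (hxy : B.IsGenerated P σ L x y)
    (hinactive : ∀ k, B.LastInactive P (SepConvex.gam L (k + 1))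
      (SepConvex.Smoother.yHat P L x y k)) :
    IsLeast ((fun z => ‖z‖) '' P.dualSolutions) P.dualRadius ∧
    ∀ k : ℕ,
      x k ∈ P.constraint ∩ P.domain ∧
      ‖P.res (x k)‖ ≤
        2 * √(2 * L) * (P.dualRadius + √(B.proxDiameter P)) / ((k : ℝ) + 1) ∧
      -P.dualRadius * ‖P.res (x k)‖ ≤ P.obj (x k) - P.optValue ∧
      P.obj (x k) - P.optValue ≤ 2 * √(2 * L) / ((k : ℝ) + 1) * B.proxDiameter P :=
  corollary5p2_general P hP B σ hB hD L hL x y hxy
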